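/- Let $n\ge 2$. For a domain (nonempty connected open set) $D\subset\mathbb C^n$, let $l_D(z,w)=\inf\{\tanh^{-1}|\alpha|\}$, where the infimum is over all $\alpha$ in the open unit disc $\mathbb D\subset\mathbb C$ for which there is a holomorphic map $\varphi:\mathbb D\to D$ with $\varphi(0)=z$ and $\varphi(\alpha)=w$, and let the Kobayashi distance $k_D$ be the largest pseudodistance on $D$ not exceeding $l_D$. Two distances $d_1,d_2$ on a set $X$ are called quasi-isometrically equivalent if there are constants $c_1,c_2>0$ such that $c_1^{-1}d_1(x,y)-c_2\le d_2(x,y)\le c_1d_1(x,y)+c_2$ for all $x,y\in X$. A metric space $(X,d)$ is called Gromov hyperbolic if, with $(x,y)_z=d(x,z)+d(z,y)-d(x,y)$, $$\sup_{p,q,x,w\in X}\bigl(\min\{(p,x)_w,(x,q)_w\}-(p,q)_w\bigr)<\infty .$$ Let $G\subset\mathbb C^n$ be a bounded domain and let $K$ be a compact subset of $G$ such that through any point $z\in\mathbb C^n\setminus K$ passes a complex line disjoint from $K$. Then $G\setminus K$ is a domain, $k_{G\setminus K}$ and the restriction of $k_G$ to $G\setminus K$ are distances on $G\setminus K$, and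 they are quasi-isometrically equivalent. In particular, if $(G,k_G)$ is Gromov hyperbolic, then so is $(G\setminus K,k_{G\setminus K})$. Moreover, the hypothesis on complex lines holds for every compact convex set $K\subset\mathbb C^n$. -/

import Mathlib

open scoped ENNReal

noncomputable section

/-- The complex Euclidean space of dimension `n`. -/
abbrev Cn (n : ℕ) : Type := EuclideanSpace ℂ (Fin n)

/-- A domain: a nonempty, connected, open set. -/
def IsDomainSet {n : ℕ} (D : Set (Cn n)) : Prop :=
  IsOpen D ∧ IsConnected D

/-- Through any point outside `K` passes a complex line (a complex affine subspace of complex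
dimension one) that is disjoint from `K`. -/
def LinesAvoid {n : ℕ} (K : Set (Cn n)) : Prop :=
  ∀ z : Cn n, z ∉ K → ∃ L : AffineSubspace ℂ (Cn n),
    z ∈ L ∧ Module.finrank ℂ L.direction = 1 ∧ Disjoint (L : Set (Cn n)) K

/-- The Lempert function of `D`: the infimum of `artanh |α|` over all `α` in the unit disc for which
there is a holomorphic map `φ` from the unit disc to `D` with `φ 0 = z` and `φ α = w`
(infinite if there is no such `α`). -/
def lempert {n : ℕ} (D : Set (Cn n)) (z w : Cn n) : ℝ≥0∞ :=
  ⨅ (α : ℂ) (_ : α ∈ Metric.ball (0 : ℂ) 1)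
    (_ : ∃ φ : ℂ → Cn n, DifferentiableOn ℂ φ (Metric.ball 0 1) ∧
      Set.MapsTo φ (Metric.ball 0 1) D ∧ φ 0 = z ∧ φ α = w),
    ENNReal.ofReal (Real.artanh ‖α‖)

/-- The largest `[0, ∞]`-valued pseudodistance on `D` that does not exceed the Lempert function. -/
def kobayashiE {n : ℕ} (D : Set (Cn n)) (z w : D) : ℝ≥0∞ :=
  ⨆ (d : PseudoMetric D ℝ≥0∞) (_ : ∀ x y : D, d x y ≤ lempert D x y), d z w

/-- The Kobayashi (pseudo)distance of `D`, as a real number. (The value `kobayashiE D z w` is finite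
when `D` is a domain. Below, `IsDistance` excludes the value `∞` for the functions it is applied
to, since `∞` would be sent to `0`.) -/
def kobayashi {n : ℕ} (D : Set (Cn n)) (z w : D) : ℝ :=
  (kobayashiE D z w).toReal

/-- `d` is a distance: `(X, d)` is a metric space. -/
structure IsDistance {X : Type*} (d : X → X → ℝ) : Prop where
  nonneg : ∀ x y, 0 ≤ d x y
  eq_zero_iff : ∀ x y, d x y = 0 ↔ x = y
  symm : ∀ x y, d x y = d y x
  triangle : ∀ x y z, d x z ≤ d x y + d y z

/-- The map `φ` from the metric space `(X₁, d₁)` to the metric space `(X₂, d₂)` is a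
quasi-isometry. -/
def IsQuasiIsometry {X₁ X₂ : Type*} (d₁ : X₁ → X₁ → ℝ) (d₂ : X₂ → X₂ → ℝ) (φ : X₁ → X₂) : Prop :=
  IsDistance d₁ ∧ IsDistance d₂ ∧ ∃ c₁ c₂ : ℝ, 0 < c₁ ∧ 0 < c₂ ∧ ∀ x y : X₁,
    c₁⁻¹ * d₁ x y - c₂ ≤ d₂ (φ x) (φ y) ∧ d₂ (φ x) (φ y) ≤ c₁ * d₁ x y + c₂

/-- Two distances on `X` are quasi-isometrically equivalent. -/
def QuasiIsometricallyEquivalent {X : Type*} (d₁ d₂ : X → X → ℝ) : Prop :=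
  IsQuasiIsometry d₁ d₂ id

/-- The Gromov product `(x, y)_z` (in the normalization without the factor `1 / 2`). -/
def gromovProduct {X : Type*} (d : X → X → ℝ) (x y z : X) : ℝ :=
  d x z + d z y - d x y

/-- The metric space `(X, d)` is Gromov hyperbolic: the supremum of
`min {(p, x)_w, (x, q)_w} - (p, q)_w` over all `p, q, x, w` is finite. -/
def GromovHyperbolic {X : Type*} (d : X → X → ℝ) : Prop :=
  IsDistance d ∧ ∃ C : ℝ, ∀ p q x w : X,
    min (gromovProduct d p x w) (gromovProduct d x q w) - gromovProduct d p q w ≤ C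

end

/-! Since G∖K lies in G, its Kobayashi distance dominates that of G. The content is the reverse
bound k_{G∖K} ≤ k_G + C (`exists_chainDist_diff_le`), which yields the quasi-isometric equivalence
and preserves Gromov hyperbolicity.

The Kobayashi distance is the infimum of the lengths of chains of short discs
(`IsDomainSet.kobayashiE_eq`). Take a nearly shortest chain in G from z to w. A disc centred at
distance at least s from K can be shrunk so as to avoid K (`HolStep.localize`), and a short step
then becomes longer by a fraction of order e^{-2s}. K stays within bounded distance of a base point,
so the triangle inequality makes the distance from the chain to K grow linearly in |c - τ|, where c
is the length travelled and τ a fixed parameter. The total loss is therefore bounded, like the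
integral of e^{-2|t|}; increments of tanh account for it.

The part of the chain between its first entry into a small neighbourhood of K and its last exit is
discarded and replaced by a chain of bounded length (`exists_bound_near`). This is where the complex
lines enter: discs in a line avoiding K lead out of the neighbourhood to a compact shell.

G∖K is connected by unicoherence of the whole space, applied to G and the complement of K. -/

open scoped ENNReal

/-! ### Connectedness of G∖K, and lines avoiding a convex set -/

open Set in
/-- Unicoherence of normed spaces: two connected open sets that cover the space meet in a
connected set. -/
theorem isPreconnected_inter_of_union_eq_univ {E : Type*} [NormedAddCommGroup E] [NormedSpace ℝ E]
    {U V : Set E} (hU : IsOpen U) (hV : IsOpen V) (hUc : IsPreconnected U) (hVc : IsPreconnected V)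
    (hUV : U ∪ V = univ) : IsPreconnected (U ∩ V) := by
  classical
  intro u v hu hv huv hAne hBne
  by_contra hempty
  set A : Set E := U ∩ V ∩ u with hA
  set B : Set E := U ∩ V ∩ v with hB
  have hAo : IsOpen A := (hU.inter hV).inter hu
  have hBo : IsOpen B := (hU.inter hV).inter hv
  have hAB : Disjoint A B := by
    rw [Set.disjoint_left]
    rintro x ⟨hx, hxu⟩ ⟨-, hxv⟩
    exact hempty ⟨x, hx, hxu, hxv⟩
  have hfr : ∀ x ∈ frontier A, x ∉ U ∩ V := by
    intro x hx hxUV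
    have hxA : x ∉ A := by
      rw [hAo.frontier_eq] at hx
      exact hx.2
    have hxB : x ∈ B := by
      rcases huv hxUV with h | h
      · exact absurd ⟨hxUV, h⟩ hxA
      · exact ⟨hxUV, h⟩
    have := (hAB.closure_left hBo)
    exact Set.disjoint_left.1 this (frontier_subset_closure hx) hxB
  obtain ⟨h, h0, h1, -⟩ := exists_continuous_zero_one_of_isClosed hV.isClosed_compl
    hU.isClosed_compl (by
      rw [Set.disjoint_left]
      intro x hx hx'
      rcases (hUV ▸ mem_univ x : x ∈ U ∪ V) with h | h
      · exact hx' h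
      · exact hx h)
  -- Circle-valued map that winds by h across A and is constant elsewhere. On the frontier of A,
  -- which misses U ∩ V, h is 0 or 1, so the two branches agree modulo 1.
  have hF : Continuous (fun x => if x ∈ A then ((h x : ℝ) : AddCircle (1 : ℝ)) else 0) := by
    refine Continuous.if ?_ (by fun_prop) continuous_const
    intro x hx
    have hx' := hfr x hx
    by_cases hxU : x ∈ U
    · have : h x = 0 := h0 (fun hxV => hx' ⟨hxU, hxV⟩)
      simp [this]
    · have : h x = 1 := h1 hxU
      rw [this]
      exact AddCircle.coe_period 1
  obtain ⟨g, ⟨-, hg⟩, -⟩ := (AddCircle.isCoveringMap_coe (1 : ℝ)).existsUnique_continuousMap_lifts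
    (A := E) ⟨_, hF⟩ hBne.some 0 (by
      have : hBne.some ∉ A := fun hA' => Set.disjoint_left.1 hAB hA' hBne.some_mem
      simp [this])
  have hgx : ∀ x, ((g x : ℝ) : AddCircle (1 : ℝ)) = if x ∈ A then ((h x : ℝ) : AddCircle (1 : ℝ))
      else 0 := fun x => congrFun hg x
  have hdisc : IsDiscrete (range ((↑) : ℤ → ℝ)) :=
    ⟨Int.isClosedEmbedding_coe_real.isEmbedding.toHomeomorph.symm.isEmbedding.discreteTopology⟩
  -- The lift g minus a suitable real lift of the circle map over W is integer-valued and
  -- continuous, hence constant on connected W. The value off A is 0 for W = U and 1 for W = V.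
  have key : ∀ (W : Set E) (a : ℤ), IsPreconnected W → (∀ x ∈ W ∩ frontier A, h x = a) →
      ∃ c : ℤ, ∀ x ∈ W, g x - (if x ∈ A then h x else (a : ℝ)) = c := by
    intro W a hW hWA
    have hc : ContinuousOn (fun x => g x - (if x ∈ A then h x else (a : ℝ))) W := by
      refine ContinuousOn.sub (by fun_prop) ?_
      exact ContinuousOn.if hWA (by fun_prop) continuousOn_const
    obtain ⟨y, ⟨c, rfl⟩, hy⟩ := hW.eqOn_const_of_mapsTo hdisc hc (by
      intro x hx
      have : ((g x - (if x ∈ A then h x else (a : ℝ)) : ℝ) : AddCircle (1 : ℝ)) = 0 := by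
        rw [AddCircle.coe_sub, hgx]
        split_ifs
        · simp
        · rw [zero_sub, neg_eq_zero, AddCircle.coe_eq_zero_iff]
          exact ⟨a, by simp⟩
      rw [AddCircle.coe_eq_zero_iff] at this
      obtain ⟨m, hm⟩ := this
      exact ⟨m, by simpa using hm⟩) ⟨0, 0, by simp⟩
    exact ⟨c, hy⟩
  obtain ⟨c, hc⟩ := key U 0 hUc (fun x hx => by
    simpa using h0 (fun hxV => hfr x hx.2 ⟨hx.1, hxV⟩))
  obtain ⟨c', hc'⟩ := key V 1 hVc (fun x hx => by
    simpa using h1 (fun hxU => hfr x hx.2 ⟨hxU, hx.1⟩))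
  -- Comparing the constants of U and V at p ∈ A gives c = c', at q ∈ B gives c = c' + 1.
  obtain ⟨p, hp⟩ := hAne
  obtain ⟨q, hq⟩ := hBne
  have hpA : p ∈ A := ⟨hp.1, hp.2⟩
  have hqA : q ∉ A := fun hA' => Set.disjoint_left.1 hAB hA' hq
  have e1 := hc p hp.1.1
  have e2 := hc' p hp.1.2
  have e3 := hc q hq.1.1
  have e4 := hc' q hq.1.2
  simp only [hpA, hqA, if_true, if_false] at e1 e2 e3 e4
  push_cast at e3 e4
  linarith

open Set Metric in
theorem isPreconnected_compl_ball {E : Type*} [NormedAddCommGroup E] [NormedSpace ℝ E]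
    (h : 1 < Module.rank ℝ E) {r : ℝ} (hr : 0 < r) : IsPreconnected (ball (0 : E) r)ᶜ := by
  have hs : IsPreconnected (sphere (0 : E) r) := isPreconnected_sphere h 0 r
  have : (ball (0 : E) r)ᶜ = (fun p : ℝ × E => p.1 • p.2) '' (Ici 1 ×ˢ sphere (0 : E) r) := by
    ext x
    simp only [mem_compl_iff, mem_ball, dist_zero_right, not_lt, mem_image, mem_prod, mem_Ici,
      mem_sphere, Prod.exists]
    constructor
    · intro hx
      have hx0 : 0 < ‖x‖ := hr.trans_le hx
      refine ⟨‖x‖ / r, (r / ‖x‖) • x, ⟨(one_le_div hr).2 hx, ?_⟩, ?_⟩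
      · rw [norm_smul, Real.norm_of_nonneg (by positivity)]
        field_simp
      · rw [smul_smul]
        field_simp
        simp
    · rintro ⟨a, y, ⟨ha, hy⟩, rfl⟩
      rw [norm_smul, hy, Real.norm_of_nonneg (by linarith)]
      nlinarith
  rw [this]
  exact (isPreconnected_Ici.prod hs).image _ (by fun_prop)

theorem one_lt_rank_Cn {n : ℕ} (hn : 2 ≤ n) : 1 < Module.rank ℝ (Cn n) := by
  have h : Module.finrank ℝ (Cn n) = 2 * n := by
    rw [← Module.finrank_mul_finrank ℝ ℂ (Cn n)]
    simp
  rw [← Module.finrank_eq_rank, h]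
  exact_mod_cast (by omega : 1 < 2 * n)

/-- A line avoiding `K`, in terms of a unit direction vector. -/
theorem LinesAvoid.exists_direction {n : ℕ} {K : Set (Cn n)} (hK : LinesAvoid K) {z : Cn n}
    (hz : z ∉ K) : ∃ u : Cn n, ‖u‖ = 1 ∧ ∀ c : ℂ, z + c • u ∉ K := by
  obtain ⟨L, hzL, hL, hd⟩ := hK z hz
  have hpos : 0 < Module.finrank ℂ L.direction := by omega
  have := Module.nontrivial_of_finrank_pos hpos
  obtain ⟨v, hv⟩ := exists_ne (0 : L.direction)
  have hv0 : (v : Cn n) ≠ 0 := by simpa using hv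
  refine ⟨((‖(v : Cn n)‖⁻¹ : ℝ) : ℂ) • (v : Cn n), ?_, fun c hc => ?_⟩
  · rw [norm_smul]
    simp [hv0]
  · refine Set.disjoint_left.1 hd ?_ hc
    rw [smul_smul, add_comm]
    exact AffineSubspace.vadd_mem_of_mem_direction (L.direction.smul_mem _ v.2) hzL

-- Every point off K is joined to the connected exterior of a large ball by a line avoiding K, since
-- a complex line is unbounded.
open Set Metric in
theorem isPreconnected_compl_of_linesAvoid {n : ℕ} (hn : 2 ≤ n) {K : Set (Cn n)}
    (hK : IsCompact K) (hL : LinesAvoid K) : IsPreconnected Kᶜ := by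
  obtain ⟨r, hr, hKr⟩ := hK.isBounded.subset_ball_lt 0 0
  have hout := isPreconnected_compl_ball (one_lt_rank_Cn hn) hr
  have hsub : (ball (0 : Cn n) r)ᶜ ⊆ Kᶜ := compl_subset_compl.2 hKr
  have : Nontrivial (Cn n) := by
    have : Nonempty (Fin n) := ⟨⟨0, by omega⟩⟩
    infer_instance
  obtain ⟨p, hp⟩ : ((ball (0 : Cn n) r)ᶜ).Nonempty := by
    obtain ⟨p, hp⟩ := NormedSpace.exists_lt_norm ℝ (Cn n) r
    exact ⟨p, by simpa using hp.le⟩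
  refine isPreconnected_of_forall p fun z hz => ?_
  obtain ⟨u, hu, hKu⟩ := hL.exists_direction hz
  set ℓ : Set (Cn n) := range (fun c : ℂ => z + c • u) with hℓ
  have hℓc : IsPreconnected ℓ := isPreconnected_range (by fun_prop)
  refine ⟨ℓ ∪ (ball (0 : Cn n) r)ᶜ, ?_, Or.inr hp, Or.inl ⟨0, by simp⟩, ?_⟩
  · refine union_subset ?_ hsub
    rintro _ ⟨c, rfl⟩
    exact hKu c
  · refine hℓc.union' ?_ hout
    refine ⟨z + ((r + ‖z‖ : ℝ) : ℂ) • u, ⟨_, rfl⟩, ?_⟩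
    have h1 : ‖((r + ‖z‖ : ℝ) : ℂ) • u‖ = r + ‖z‖ := by
      rw [norm_smul, hu, Complex.norm_real, Real.norm_of_nonneg (by positivity), mul_one]
    have h2 := norm_sub_norm_le (((r + ‖z‖ : ℝ) : ℂ) • u) (-z)
    rw [norm_neg, sub_neg_eq_add, add_comm _ z] at h2
    simp only [mem_compl_iff, mem_ball, dist_zero_right, not_lt]
    linarith

theorem isDomainSet_diff {n : ℕ} (hn : 2 ≤ n) {G K : Set (Cn n)} (hG : IsDomainSet G)
    (hK : IsCompact K) (hKG : K ⊆ G) (hL : LinesAvoid K) : IsDomainSet (G \ K) := by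
  refine ⟨hG.1.sdiff hK.isClosed, ?_, ?_⟩
  · by_contra hne
    rw [Set.not_nonempty_iff_eq_empty, Set.sdiff_eq_empty] at hne
    obtain rfl := hKG.antisymm hne
    have : Nontrivial (Cn n) := by
      have : Nonempty (Fin n) := ⟨⟨0, by omega⟩⟩
      infer_instance
    rcases isClopen_iff.1 ⟨hK.isClosed, hG.1⟩ with h | h
    · exact hG.2.nonempty.ne_empty h
    · exact NormedSpace.noncompactSpace ℝ (Cn n) |>.noncompact_univ (h ▸ hK)
  · refine isPreconnected_inter_of_union_eq_univ hG.1 hK.isClosed.isOpen_compl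
      hG.2.isPreconnected (isPreconnected_compl_of_linesAvoid hn hK hL) ?_
    refine Set.eq_univ_of_forall fun x => ?_
    by_cases hx : x ∈ K
    · exact Or.inl (hKG hx)
    · exact Or.inr hx

/-- A complex functional f whose real part separates z from K is constant on lines in the directions
of its kernel, and this kernel is nonzero because n ≥ 2. -/
theorem linesAvoid_of_convex {n : ℕ} (hn : 2 ≤ n) {K : Set (Cn n)} (hK : IsCompact K)
    (hc : Convex ℝ K) : LinesAvoid K := by
  intro z hz
  obtain ⟨f, u, hfK, hfz⟩ := RCLike.geometric_hahn_banach_closed_point (𝕜 := ℂ) hc hK.isClosed hz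
  have hker : 0 < Module.finrank ℂ (LinearMap.ker (f : Cn n →ₗ[ℂ] ℂ)) := by
    have h1 := LinearMap.finrank_range_add_finrank_ker (f : Cn n →ₗ[ℂ] ℂ)
    have h2 := Submodule.finrank_le (LinearMap.range (f : Cn n →ₗ[ℂ] ℂ))
    simp only [Module.finrank_self, finrank_euclideanSpace, Fintype.card_fin] at h1 h2
    omega
  have := Module.nontrivial_of_finrank_pos hker
  obtain ⟨v, hv⟩ := exists_ne (0 : LinearMap.ker (f : Cn n →ₗ[ℂ] ℂ))
  have hv0 : (v : Cn n) ≠ 0 := by simpa using hv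
  refine ⟨AffineSubspace.mk' z (ℂ ∙ (v : Cn n)), AffineSubspace.self_mem_mk' _ _, ?_, ?_⟩
  · rw [AffineSubspace.direction_mk']
    exact finrank_span_singleton hv0
  · rw [Set.disjoint_left]
    intro x hx hxK
    rw [SetLike.mem_coe, AffineSubspace.mem_mk', Submodule.mem_span_singleton] at hx
    obtain ⟨a, ha⟩ := hx
    have h1 : f x = f z := by
      have h2 : f (x -ᵥ z) = 0 := by
        rw [← ha, map_smul, show f v = 0 from v.2, smul_zero]
      rwa [vsub_eq_sub, map_sub, sub_eq_zero] at h2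
    have h3 := hfK x hxK
    rw [h1] at h3
    exact lt_asymm h3 hfz

/-! ### Elementary facts on tanh -/

theorem Real.tanh_sub' (a b : ℝ) :
    Real.tanh (b - a) * (1 - Real.tanh a * Real.tanh b) = Real.tanh b - Real.tanh a := by
  have ha := (Real.cosh_pos a).ne'
  have hb := (Real.cosh_pos b).ne'
  have hab := (Real.cosh_pos (b - a)).ne'
  rw [Real.tanh_eq_sinh_div_cosh, Real.tanh_eq_sinh_div_cosh, Real.tanh_eq_sinh_div_cosh]
  field_simp
  rw [Real.sinh_sub, Real.cosh_sub]
  ring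

theorem Real.tanh_le_tanh_iff {a b : ℝ} : Real.tanh a ≤ Real.tanh b ↔ a ≤ b := by
  have h := Real.artanh_le_artanh_iff ⟨Real.neg_one_lt_tanh a, Real.tanh_lt_one a⟩
    ⟨Real.neg_one_lt_tanh b, Real.tanh_lt_one b⟩
  rw [Real.artanh_tanh, Real.artanh_tanh] at h
  exact h.symm

theorem Real.tanh_lt_tanh_iff {a b : ℝ} : Real.tanh a < Real.tanh b ↔ a < b :=
  lt_iff_lt_of_le_iff_le Real.tanh_le_tanh_iff

theorem Real.tanh_nonneg {a : ℝ} (ha : 0 ≤ a) : 0 ≤ Real.tanh a := by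
  simpa using Real.tanh_le_tanh_iff.2 ha

theorem Real.tanh_pos {a : ℝ} (ha : 0 < a) : 0 < Real.tanh a := by
  simpa using Real.tanh_lt_tanh_iff.2 ha

theorem Real.tanh_le_two_mul {h : ℝ} (hh : 0 ≤ h) : Real.tanh h ≤ 2 * h := by
  have h1 := Real.add_one_le_exp (-h + -h)
  rw [Real.exp_add] at h1
  have h2 : Real.exp h * Real.exp (-h) = 1 := by rw [← Real.exp_add]; simp
  have h3 := Real.exp_pos h
  have h4 := Real.exp_pos (-h)
  rw [Real.tanh_eq, div_le_iff₀ (by positivity)]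
  nlinarith [mul_nonneg hh h4.le, mul_nonneg hh h3.le, mul_le_mul_of_nonneg_left h1 h3.le]

/-! ### Holomorphic discs and chains of discs -/

open Metric Set

variable {n : ℕ}

/-- A holomorphic map from the unit disc to `D`. -/
structure HolDisc (D : Set (Cn n)) (φ : ℂ → Cn n) : Prop where
  diff : DifferentiableOn ℂ φ (ball 0 1)
  maps : MapsTo φ (ball 0 1) D

theorem HolDisc.comp {D : Set (Cn n)} {φ : ℂ → Cn n} (hφ : HolDisc D φ) {m : ℂ → ℂ}
    (hd : DifferentiableOn ℂ m (ball 0 1)) (hm : MapsTo m (ball 0 1) (ball 0 1)) :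
    HolDisc D (φ ∘ m) :=
  ⟨hφ.diff.comp hd hm, hφ.maps.comp hm⟩

/-- A holomorphic disc in `D` takes two points at Poincaré distance `h` to `x` and `y`. -/
def HolStep (D : Set (Cn n)) (x y : Cn n) (h : ℝ) : Prop :=
  0 ≤ h ∧ ∃ φ, HolDisc D φ ∧ φ 0 = x ∧ φ (Real.tanh h : ℝ) = y

theorem ofReal_tanh_mem_ball (h : ℝ) : ((Real.tanh h : ℝ) : ℂ) ∈ ball (0 : ℂ) 1 := by
  rw [mem_ball_zero_iff, Complex.norm_real]
  exact Real.abs_tanh_lt_one h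

theorem HolStep.nonneg {D : Set (Cn n)} {x y : Cn n} {h : ℝ} (hs : HolStep D x y h) : 0 ≤ h := hs.1

theorem HolStep.right_mem {D : Set (Cn n)} {x y : Cn n} {h : ℝ} (hs : HolStep D x y h) :
    y ∈ D := by
  obtain ⟨-, φ, hφ, -, rfl⟩ := hs
  exact hφ.maps (ofReal_tanh_mem_ball h)

theorem HolStep.mono {D D' : Set (Cn n)} (hD : D ⊆ D') {x y : Cn n} {h : ℝ}
    (hs : HolStep D x y h) : HolStep D' x y h := by
  obtain ⟨h0, φ, hφ, hx, hy⟩ := hs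
  exact ⟨h0, φ, ⟨hφ.diff, hφ.maps.mono_right hD⟩, hx, hy⟩

theorem HolDisc.step {D : Set (Cn n)} {φ : ℂ → Cn n} (hφ : HolDisc D φ) {α : ℂ}
    (hα : α ∈ ball (0 : ℂ) 1) : HolStep D (φ 0) (φ α) (Real.artanh ‖α‖) := by
  rw [mem_ball_zero_iff] at hα
  refine ⟨Real.artanh_nonneg (norm_nonneg α), φ ∘ fun l => l * (α / (‖α‖ : ℂ)),
    hφ.comp (by fun_prop) ?_, by simp, ?_⟩
  · intro l hl
    rw [mem_ball_zero_iff] at hl ⊢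
    have : ‖α / (‖α‖ : ℂ)‖ ≤ 1 := by
      rw [norm_div, Complex.norm_real, norm_norm]
      exact div_self_le_one _
    calc ‖l * (α / (‖α‖ : ℂ))‖ = ‖l‖ * ‖α / (‖α‖ : ℂ)‖ := norm_mul _ _
      _ ≤ ‖l‖ * 1 := by gcongr
      _ < 1 := by simpa using hl
  · rw [Real.tanh_artanh ⟨by linarith [norm_nonneg α], hα⟩, Function.comp_apply]
    congr 1
    by_cases h : α = 0
    · simp [h]
    · have : (‖α‖ : ℂ) ≠ 0 := by simpa using h
      field_simp

theorem norm_add_lt_norm_one_add_mul {a : ℝ} (ha : |a| < 1) {l : ℂ} (hl : ‖l‖ < 1) :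
    ‖l + a‖ < ‖1 + a * l‖ := by
  have h1 : a ^ 2 < 1 := (sq_lt_one_iff_abs_lt_one a).2 ha
  have h2 : ‖l‖ ^ 2 < 1 := by nlinarith [norm_nonneg l]
  rw [← sq_lt_sq₀ (norm_nonneg _) (norm_nonneg _)]
  rw [Complex.sq_norm, Complex.normSq_apply] at h2 ⊢
  rw [Complex.sq_norm, Complex.normSq_apply]
  simp only [Complex.add_re, Complex.add_im, Complex.ofReal_re, Complex.ofReal_im, Complex.one_re,
    Complex.one_im, Complex.mul_re, Complex.mul_im]
  nlinarith

/-- The disc automorphism l ↦ (l + t)/(1 + tl) with t = tanh a moves 0 to tanh a and tanh (b - a) to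
tanh b. -/
theorem HolDisc.step_tanh {D : Set (Cn n)} {φ : ℂ → Cn n} (hφ : HolDisc D φ) {a b : ℝ}
    (hab : a ≤ b) : HolStep D (φ (Real.tanh a : ℝ)) (φ (Real.tanh b : ℝ)) (b - a) := by
  set t := Real.tanh a with ht
  have hta : |t| < 1 := Real.abs_tanh_lt_one a
  have hlt : ∀ l ∈ ball (0 : ℂ) 1, ‖l + t‖ < ‖1 + t * l‖ := fun l hl =>
    norm_add_lt_norm_one_add_mul hta (by simpa using hl)
  have hne : ∀ l ∈ ball (0 : ℂ) 1, 1 + (t : ℂ) * l ≠ 0 := fun l hl =>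
    norm_pos_iff.1 ((norm_nonneg _).trans_lt (hlt l hl))
  refine ⟨sub_nonneg.2 hab, φ ∘ fun l => (l + t) / (1 + t * l), hφ.comp ?_ ?_, by simp, ?_⟩
  · exact DifferentiableOn.div (by fun_prop) (by fun_prop) hne
  · intro l hl
    rw [mem_ball_zero_iff, norm_div, div_lt_one (norm_pos_iff.2 (hne l hl))]
    exact hlt l hl
  · rw [Function.comp_apply]
    congr 1
    rw [div_eq_iff (hne _ (ofReal_tanh_mem_ball _))]
    have := Real.tanh_sub' a b
    rw [← ht] at this
    exact_mod_cast (by linarith : Real.tanh (b - a) + t = Real.tanh b * (1 + t * Real.tanh (b - a)))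

theorem HolStep.symm {D : Set (Cn n)} {x y : Cn n} {h : ℝ} (hs : HolStep D x y h) :
    HolStep D y x h := by
  obtain ⟨h0, φ, hφ, rfl, rfl⟩ := hs
  have hφ' : HolDisc D (φ ∘ fun l => -l) := hφ.comp (by fun_prop) (fun l hl => by simpa using hl)
  have := hφ'.step_tanh (a := -h) (b := 0) (by linarith)
  simpa using this

/-- A chain of holomorphic discs in `D` from `x` to `y` with steps of length at most `δ` and with
total length `c`. -/
inductive HolChain (D : Set (Cn n)) (δ : ℝ) (x : Cn n) : Cn n → ℝ → Prop
  | refl : x ∈ D → HolChain D δ x x 0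
  | snoc {y z : Cn n} {c h : ℝ} : HolChain D δ x y c → HolStep D y z h → h ≤ δ →
      HolChain D δ x z (c + h)

namespace HolChain

variable {D : Set (Cn n)} {δ : ℝ} {x y z : Cn n} {c c' : ℝ}

theorem left_mem (h : HolChain D δ x y c) : x ∈ D := by
  induction h with
  | refl hx => exact hx
  | snoc _ _ _ ih => exact ih

theorem right_mem (h : HolChain D δ x y c) : y ∈ D := by
  induction h with
  | refl hx => exact hx
  | snoc _ hs _ _ => exact hs.right_mem

theorem nonneg (h : HolChain D δ x y c) : 0 ≤ c := by
  induction h with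
  | refl hx => exact le_rfl
  | snoc _ hs _ ih => exact add_nonneg ih hs.nonneg

theorem trans (h : HolChain D δ x y c) (h' : HolChain D δ y z c') : HolChain D δ x z (c + c') := by
  induction h' with
  | refl hx => simpa using h
  | snoc _ hs hδ ih => rw [← add_assoc]; exact ih.snoc hs hδ

theorem symm (h : HolChain D δ x y c) : HolChain D δ y x c := by
  induction h with
  | refl hx => exact refl hx
  | snoc h hs hδ ih =>
    have := ((refl hs.right_mem).snoc hs.symm hδ).trans ih
    rwa [zero_add, add_comm] at this

end HolChain

/-- Poincaré length is additive along a diameter, so a step can be cut into N equal short ones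
without changing its total length. -/
theorem HolStep.chain {D : Set (Cn n)} {x y : Cn n} {h : ℝ} (hs : HolStep D x y h) {δ : ℝ}
    (hδ : 0 < δ) : HolChain D δ x y h := by
  obtain ⟨h0, φ, hφ, rfl, rfl⟩ := hs
  obtain ⟨N, hN⟩ := exists_nat_gt (h / δ)
  have hN0 : (0 : ℝ) < N := (div_nonneg h0 hδ.le).trans_lt hN
  have key : ∀ j : ℕ, HolChain D δ (φ 0) (φ (Real.tanh (j * (h / N)) : ℝ)) (j * (h / N)) := by
    intro j
    induction j with
    | zero => simpa using HolChain.refl (hφ.maps (by simp))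
    | succ j ih =>
      have hstep := hφ.step_tanh (a := j * (h / N)) (b := (j + 1 : ℕ) * (h / N)) (by
        push_cast; nlinarith [div_nonneg h0 hN0.le])
      have := ih.snoc hstep (by
        push_cast
        rw [add_one_mul, add_sub_cancel_left, div_le_iff₀ hN0]
        rw [div_lt_iff₀ hδ] at hN
        linarith)
      rwa [add_sub_cancel] at this
  have := key N
  rwa [mul_div_cancel₀ h hN0.ne'] at this

theorem HolChain.refine {D D' : Set (Cn n)} (hD : D ⊆ D') {δ δ' : ℝ} {x y : Cn n} {c : ℝ}
    (h : HolChain D δ x y c) (hδ : 0 < δ') : HolChain D' δ' x y c := by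
  induction h with
  | refl hx => exact .refl (hD hx)
  | snoc _ hs _ ih => exact ih.trans ((hs.mono hD).chain hδ)

/-- In a bounded set the Kobayashi distance dominates a multiple of the Euclidean distance. -/
theorem HolChain.dist_le {D : Set (Cn n)} {R : ℝ} (hR : ∀ x ∈ D, ∀ y ∈ D, dist x y ≤ R) {δ : ℝ}
    {x y : Cn n} {c : ℝ} (h : HolChain D δ x y c) : dist x y ≤ 2 * R * c := by
  induction h with
  | refl hx => simp
  | @snoc y z c h hc hs _ ih =>
    have : dist y z ≤ 2 * R * h := by
      obtain ⟨h0, φ, hφ, rfl, rfl⟩ := hs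
      have hm0 : (0 : ℂ) ∈ ball (0 : ℂ) 1 := by simp
      have := Complex.dist_le_div_mul_dist_of_mapsTo_ball (R₂ := R) hφ.diff
        (fun w hw => mem_closedBall.2 (hR _ (hφ.maps hw) _ (hφ.maps hm0))) (ofReal_tanh_mem_ball h)
      rw [dist_comm, div_one, dist_zero_right, Complex.norm_real,
        Real.norm_of_nonneg (Real.tanh_nonneg h0)] at this
      have hR0 : 0 ≤ R := dist_nonneg.trans (hR _ (hφ.maps hm0) _ (hφ.maps hm0))
      nlinarith [mul_le_mul_of_nonneg_left (Real.tanh_le_two_mul h0) hR0]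
    linarith [dist_triangle x y z]

/-- A disc in a complex line. -/
theorem holStep_of_line {D : Set (Cn n)} {x v : Cn n} (hv : ∀ l ∈ ball (0 : ℂ) 1, x + l • v ∈ D)
    {t : ℝ} (ht0 : 0 ≤ t) (ht1 : t < 1) : HolStep D x (x + (t : ℂ) • v) (Real.artanh t) := by
  have hφ : HolDisc D (fun l : ℂ => x + l • v) := ⟨by fun_prop, hv⟩
  have := hφ.step (α := (t : ℂ)) (by simpa [abs_of_nonneg ht0] using ht1)
  simpa [abs_of_nonneg ht0] using this

theorem holStep_of_ball {D : Set (Cn n)} {x y : Cn n} {r : ℝ} (hr : 0 < r) (hD : ball x r ⊆ D)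
    (hy : dist y x ≤ r / 2) : HolStep D x y (Real.artanh (1 / 2)) := by
  have := holStep_of_line (D := D) (x := x) (v := (2 : ℂ) • (y - x)) (fun l hl => hD (by
    rw [mem_ball_zero_iff] at hl
    rw [mem_ball_iff_norm, add_sub_cancel_left, norm_smul, norm_smul, ← dist_eq_norm]
    norm_num
    nlinarith [norm_nonneg l, dist_nonneg (x := y) (y := x)])) (t := 1 / 2) (by norm_num)
    (by norm_num)
  rwa [smul_smul, show ((1 / 2 : ℝ) : ℂ) * 2 = 1 by norm_num, one_smul, add_sub_cancel] at this

theorem IsDomainSet.exists_holChain {D : Set (Cn n)} (hD : IsDomainSet D) {δ : ℝ} (hδ : 0 < δ)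
    {x y : Cn n} (hx : x ∈ D) (hy : y ∈ D) : ∃ c, HolChain D δ x y c := by
  refine hD.2.isPreconnected.induction₂ (fun x y => ∃ c, HolChain D δ x y c) ?_ ?_ ?_ hx hy
  · intro x hx
    obtain ⟨r, hr, hrD⟩ := Metric.isOpen_iff.1 hD.1 x hx
    filter_upwards [mem_nhdsWithin_of_mem_nhds (closedBall_mem_nhds x (half_pos hr))] with y hy
    exact ⟨_, (holStep_of_ball hr hrD (mem_closedBall.1 hy)).chain hδ⟩
  · rintro x y z - - - ⟨c, hc⟩ ⟨c', hc'⟩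
    exact ⟨_, hc.trans hc'⟩
  · rintro x y - - ⟨c, hc⟩
    exact ⟨_, hc.symm⟩

theorem IsDomainSet.exists_bound_of_isCompact {D S : Set (Cn n)} (hD : IsDomainSet D) {δ : ℝ}
    (hδ : 0 < δ) (hS : IsCompact S) (hSD : S ⊆ D) {o : Cn n} (ho : o ∈ D) :
    ∃ R, ∀ x ∈ S, ∃ c ≤ R, HolChain D δ o x c := by
  refine hS.induction_on (p := fun S => ∃ R, ∀ x ∈ S, ∃ c ≤ R, HolChain D δ o x c) ⟨0, by simp⟩ ?_
    ?_ ?_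
  · rintro s t hst ⟨R, hR⟩
    exact ⟨R, fun x hx => hR x (hst hx)⟩
  · rintro s t ⟨R, hR⟩ ⟨R', hR'⟩
    refine ⟨max R R', ?_⟩
    rintro x (hx | hx)
    · obtain ⟨c, hc, h⟩ := hR x hx
      exact ⟨c, hc.trans (le_max_left _ _), h⟩
    · obtain ⟨c, hc, h⟩ := hR' x hx
      exact ⟨c, hc.trans (le_max_right _ _), h⟩
  · intro x hx
    obtain ⟨r, hr, hrD⟩ := Metric.isOpen_iff.1 hD.1 x (hSD hx)
    obtain ⟨c, hc⟩ := hD.exists_holChain hδ ho (hSD hx)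
    refine ⟨_, mem_nhdsWithin_of_mem_nhds (closedBall_mem_nhds x (half_pos hr)), _, fun y hy =>
      ⟨_, le_rfl, hc.trans ((holStep_of_ball hr hrD (mem_closedBall.1 hy)).chain hδ)⟩⟩

/-- Localization: a disc in `G` whose centre is at Kobayashi distance at least `s` from `K` avoids
`K` on the concentric disc of hyperbolic radius `s`. -/
theorem HolStep.localize {G K : Set (Cn n)} {x y : Cn n} {s h : ℝ} (hs : HolStep G x y h)
    (hhs : h < s) (hK : ∀ p ∈ K, ∀ c, HolChain G 1 x p c → s ≤ c) :
    HolStep (G \ K) x y (Real.artanh (Real.tanh h / Real.tanh s)) := by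
  obtain ⟨h0, φ, hφ, rfl, rfl⟩ := hs
  have hs0 : 0 < s := h0.trans_lt hhs
  have hts := Real.tanh_pos hs0
  have hts1 := Real.tanh_lt_one s
  have hth := Real.tanh_nonneg h0
  have hlt := Real.tanh_lt_tanh_iff.2 hhs
  have hm : ∀ l ∈ ball (0 : ℂ) 1, (Real.tanh s : ℂ) * l ∈ ball (0 : ℂ) (Real.tanh s) := by
    intro l hl
    rw [mem_ball_zero_iff] at hl ⊢
    rw [norm_mul, Complex.norm_real, Real.norm_of_nonneg hts.le]
    nlinarith
  have hφ' : HolDisc (G \ K) (φ ∘ fun l => (Real.tanh s : ℂ) * l) := by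
    have h1 := hφ.comp (m := fun l => (Real.tanh s : ℂ) * l) (by fun_prop)
      (fun l hl => ball_subset_ball hts1.le (hm l hl))
    refine ⟨h1.diff, fun l hl => ⟨h1.maps hl, fun hlK => ?_⟩⟩
    have hmem := hm l hl
    rw [mem_ball_zero_iff] at hmem
    have h2 := hφ.step (ball_subset_ball hts1.le (hm l hl))
    have h3 := hK _ hlK _ (h2.chain one_pos)
    have h4 := Real.artanh_lt_artanh (by linarith [norm_nonneg ((Real.tanh s : ℂ) * l)]) hts1 hmem
    rw [Real.artanh_tanh] at h4
    linarith
  have hq0 : 0 ≤ Real.tanh h / Real.tanh s := div_nonneg hth hts.le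
  have hq1 : Real.tanh h / Real.tanh s < 1 := (div_lt_one hts).2 hlt
  have := hφ'.step (α := ((Real.tanh h / Real.tanh s : ℝ) : ℂ))
    (by rwa [mem_ball_zero_iff, Complex.norm_real, Real.norm_of_nonneg hq0])
  rw [Complex.norm_real, Real.norm_of_nonneg hq0, Function.comp_apply, Function.comp_apply,
    mul_zero] at this
  convert this using 2
  push_cast
  rw [mul_div_cancel₀]
  exact_mod_cast hts.ne'

/-! ### The Kobayashi distance as an infimum over chains -/

/-- The infimum of the lengths of the chains of holomorphic discs. -/
noncomputable def chainDist (D : Set (Cn n)) (x y : Cn n) : ℝ :=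
  sInf {c | HolChain D 1 x y c}

theorem chainDist_nonneg (D : Set (Cn n)) (x y : Cn n) : 0 ≤ chainDist D x y :=
  Real.sInf_nonneg fun _ hc => hc.nonneg

theorem chainDist_comm (D : Set (Cn n)) (x y : Cn n) : chainDist D x y = chainDist D y x := by
  unfold chainDist
  congr 1
  ext c
  exact ⟨HolChain.symm, HolChain.symm⟩

theorem HolChain.chainDist_le {D : Set (Cn n)} {x y : Cn n} {δ c : ℝ} (h : HolChain D δ x y c) :
    chainDist D x y ≤ c :=
  csInf_le ⟨0, fun _ hc => hc.nonneg⟩ (h.refine subset_rfl one_pos)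

theorem chainDist_self {D : Set (Cn n)} {x : Cn n} (hx : x ∈ D) : chainDist D x x = 0 :=
  (HolChain.refl (δ := 1) hx).chainDist_le.antisymm (chainDist_nonneg D x x)

namespace IsDomainSet

variable {D : Set (Cn n)} (hD : IsDomainSet D) {x y z : Cn n} (hx : x ∈ D) (hy : y ∈ D)
include hD hx hy

theorem exists_holChain_lt {δ : ℝ} (hδ : 0 < δ) {c : ℝ} (hc : chainDist D x y < c) :
    ∃ c' < c, HolChain D δ x y c' := by
  obtain ⟨c', hc', h⟩ := exists_lt_of_csInf_lt (hD.exists_holChain one_pos hx hy) hc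
  exact ⟨c', h, HolChain.refine subset_rfl hc' hδ⟩

theorem chainDist_triangle (hz : z ∈ D) :
    chainDist D x z ≤ chainDist D x y + chainDist D y z := by
  refine le_of_forall_pos_le_add fun ε hε => ?_
  obtain ⟨c, hc, h⟩ := hD.exists_holChain_lt hx hy one_pos
    (lt_add_of_pos_right (chainDist D x y) (half_pos hε))
  obtain ⟨c', hc', h'⟩ := hD.exists_holChain_lt hy hz one_pos
    (lt_add_of_pos_right (chainDist D y z) (half_pos hε))
  linarith [(h.trans h').chainDist_le]

theorem le_chainDist {a : ℝ} (h : ∀ c, HolChain D 1 x y c → a ≤ c) : a ≤ chainDist D x y :=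
  le_csInf (hD.exists_holChain one_pos hx hy) h

end IsDomainSet

theorem HolStep.lempert_le {D : Set (Cn n)} {x y : Cn n} {h : ℝ} (hs : HolStep D x y h) :
    lempert D x y ≤ ENNReal.ofReal h := by
  obtain ⟨h0, φ, hφ, hx, hy⟩ := hs
  refine iInf_le_of_le _ (iInf_le_of_le (ofReal_tanh_mem_ball h) (iInf_le_of_le
    ⟨φ, hφ.diff, hφ.maps, hx, hy⟩ ?_))
  rw [Complex.norm_real, Real.norm_of_nonneg (Real.tanh_nonneg h0), Real.artanh_tanh]

/-- A pseudodistance below the Lempert function is at most the length of any chain, by the triangle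
inequality; conversely the chain infimum is itself such a pseudodistance. -/
theorem IsDomainSet.kobayashiE_eq {D : Set (Cn n)} (hD : IsDomainSet D) (z w : D) :
    kobayashiE D z w = ENNReal.ofReal (chainDist D z w) := by
  refine le_antisymm (iSup₂_le fun d hd => ?_) ?_
  · have key : ∀ y c, HolChain D 1 z y c → ∀ hy : y ∈ D, d z ⟨y, hy⟩ ≤ ENNReal.ofReal c := by
      intro y c h
      induction h with
      | refl hx => intro hy; simp
      | @snoc y y' c h hc hs _ ih =>
        intro hy
        have hy0 := hc.right_mem
        calc d z ⟨y', hy⟩ ≤ d z ⟨y, hy0⟩ + d ⟨y, hy0⟩ ⟨y', hy⟩ := d.triangle _ _ _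
          _ ≤ ENNReal.ofReal c + ENNReal.ofReal h :=
            add_le_add (ih hy0) ((hd _ _).trans hs.lempert_le)
          _ = ENNReal.ofReal (c + h) := (ENNReal.ofReal_add hc.nonneg hs.nonneg).symm
    refine le_of_forall_gt_imp_ge_of_dense fun b hb => ?_
    by_cases hbt : b = ⊤
    · simp [hbt]
    rw [ENNReal.ofReal_lt_iff_lt_toReal (chainDist_nonneg _ _ _) hbt] at hb
    obtain ⟨c, hc, h⟩ := hD.exists_holChain_lt z.2 w.2 one_pos hb
    exact (key w c h w.2).trans (ENNReal.ofReal_le_of_le_toReal hc.le)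
  · refine le_iSup₂_of_le (f := fun (d : PseudoMetric D ℝ≥0∞)
      (_ : ∀ x y : D, d x y ≤ lempert D x y) => d z w)
      ⟨fun x y => ENNReal.ofReal (chainDist D x y), ?_, ?_, ?_⟩ ?_ le_rfl
    · intro x
      simp [chainDist_self x.2]
    · intro x y
      rw [chainDist_comm]
    · intro x y z
      rw [← ENNReal.ofReal_add (chainDist_nonneg _ _ _) (chainDist_nonneg _ _ _)]
      exact ENNReal.ofReal_le_ofReal (hD.chainDist_triangle x.2 y.2 z.2)
    · intro x y
      refine le_iInf₂ fun α hα => le_iInf fun ⟨φ, hd, hm, hx, hy⟩ => ?_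
      refine ENNReal.ofReal_le_ofReal ?_
      have := (HolDisc.mk hd hm).step hα
      rw [hx, hy] at this
      exact (this.chain one_pos).chainDist_le

theorem IsDomainSet.kobayashi_eq {D : Set (Cn n)} (hD : IsDomainSet D) (z w : D) :
    kobayashi D z w = chainDist D z w := by
  rw [kobayashi, hD.kobayashiE_eq, ENNReal.toReal_ofReal (chainDist_nonneg _ _ _)]

theorem IsDomainSet.eq_of_chainDist_eq_zero {D : Set (Cn n)} (hD : IsDomainSet D)
    (hb : Bornology.IsBounded D) {x y : Cn n} (hx : x ∈ D) (hy : y ∈ D)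
    (h : chainDist D x y = 0) : x = y := by
  obtain ⟨R, hR⟩ := Metric.isBounded_iff.1 hb
  have hR0 : 0 ≤ R := dist_nonneg.trans (hR hx hx)
  rw [← dist_le_zero]
  refine le_of_forall_pos_le_add fun ε hε => ?_
  obtain ⟨c, hc, hch⟩ := hD.exists_holChain_lt hx hy one_pos
    (c := ε / (2 * R + 1)) (by rw [h]; positivity)
  have h1 := hch.dist_le (fun x hx y hy => hR hx hy)
  rw [lt_div_iff₀ (by positivity)] at hc
  nlinarith [hch.nonneg]

theorem IsDomainSet.isDistance_kobayashi {D : Set (Cn n)} (hD : IsDomainSet D)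
    (hb : Bornology.IsBounded D) : IsDistance (kobayashi D) where
  nonneg _ _ := ENNReal.toReal_nonneg
  eq_zero_iff x y := by
    rw [hD.kobayashi_eq]
    refine ⟨fun h => Subtype.ext (hD.eq_of_chainDist_eq_zero hb x.2 y.2 h), ?_⟩
    rintro rfl
    exact chainDist_self x.2
  symm x y := by rw [hD.kobayashi_eq, hD.kobayashi_eq, chainDist_comm]
  triangle x y z := by
    simp only [hD.kobayashi_eq]
    exact hD.chainDist_triangle x.2 y.2 z.2

/-! ### The cost of shrinking a disc -/

/-- With q = tanh h / tanh s, (1 + q)/(1 - q) = sinh (s + h) / sinh (s - h) = e^{2h}(1 + u); then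
log (1 + u) ≤ u. -/
theorem Real.artanh_tanh_div_tanh_le {s h : ℝ} (h0 : 0 ≤ h) (hhs : h < s) :
    Real.artanh (Real.tanh h / Real.tanh s) ≤ h + Real.exp (-2 * s) *
      (Real.exp (2 * h) - Real.exp (-2 * h)) / (2 * (1 - Real.exp (-2 * (s - h)))) := by
  have hs0 : 0 < s := h0.trans_lt hhs
  have hts := Real.tanh_pos hs0
  have hq0 : 0 ≤ Real.tanh h / Real.tanh s := div_nonneg (Real.tanh_nonneg h0) hts.le
  have hq1 : Real.tanh h / Real.tanh s < 1 := (div_lt_one hts).2 (Real.tanh_lt_tanh_iff.2 hhs)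
  set u := Real.exp (-2 * s) * (Real.exp (2 * h) - Real.exp (-2 * h)) /
    (1 - Real.exp (-2 * (s - h))) with hu
  have hd : 0 < 1 - Real.exp (-2 * (s - h)) := by
    rw [sub_pos, Real.exp_lt_one_iff]
    linarith
  have hu0 : 0 ≤ u := by
    have : Real.exp (-2 * h) ≤ Real.exp (2 * h) := Real.exp_le_exp.2 (by linarith)
    have := sub_nonneg.2 this
    positivity
  have key : (1 + Real.tanh h / Real.tanh s) / (1 - Real.tanh h / Real.tanh s) =
      Real.exp (2 * h) * (1 + u) := by
    have hsh : 0 < Real.sinh s := Real.sinh_pos_iff.2 hs0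
    have hch := Real.cosh_pos h
    have hcs := Real.cosh_pos s
    have e1 : Real.tanh h / Real.tanh s =
        Real.sinh h * Real.cosh s / (Real.cosh h * Real.sinh s) := by
      rw [Real.tanh_eq_sinh_div_cosh, Real.tanh_eq_sinh_div_cosh]
      field_simp
    have hsub : 0 < Real.sinh (s - h) := Real.sinh_pos_iff.2 (sub_pos.2 hhs)
    have e2 : (1 + Real.tanh h / Real.tanh s) / (1 - Real.tanh h / Real.tanh s) =
        Real.sinh (s + h) / Real.sinh (s - h) := by
      have hne : 1 - Real.tanh h / Real.tanh s ≠ 0 := (sub_pos.2 hq1).ne'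
      rw [div_eq_div_iff hne hsub.ne', e1, Real.sinh_add, Real.sinh_sub]
      field_simp
    rw [e2, hu, div_eq_iff hsub.ne', one_add_div hd.ne', mul_div_assoc', div_mul_eq_mul_div,
      eq_div_iff hd.ne', Real.sinh_eq, Real.sinh_eq]
    have f1 : Real.exp (-2 * (s - h)) = Real.exp (-s) ^ 2 * Real.exp h ^ 2 := by
      rw [← Real.exp_nat_mul, ← Real.exp_nat_mul, ← Real.exp_add]; congr 1; push_cast; ring
    have f2 : Real.exp (-2 * s) = Real.exp (-s) ^ 2 := by
      rw [← Real.exp_nat_mul]; congr 1; push_cast; ring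
    have f3 : Real.exp (2 * h) = Real.exp h ^ 2 := by
      rw [← Real.exp_nat_mul]; congr 1
    have f4 : Real.exp (-2 * h) = Real.exp (-h) ^ 2 := by
      rw [← Real.exp_nat_mul]; congr 1; push_cast; ring
    have f5 : Real.exp (s - h) = Real.exp s * Real.exp (-h) := by rw [← Real.exp_add]; rfl
    have f6 : Real.exp (-(s - h)) = Real.exp (-s) * Real.exp h := by
      rw [← Real.exp_add]; congr 1; ring
    rw [f1, f2, f3, f4, f5, f6, neg_add, Real.exp_add, Real.exp_add, Real.exp_neg, Real.exp_neg]
    field_simp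
    ring
  rw [Real.artanh_eq_half_log ⟨by linarith, hq1.le⟩, key,
    Real.log_mul (Real.exp_pos _).ne' (by positivity), Real.log_exp]
  have := Real.log_le_sub_one_of_pos (show 0 < 1 + u by positivity)
  have e : Real.exp (-2 * s) * (Real.exp (2 * h) - Real.exp (-2 * h)) /
      (2 * (1 - Real.exp (-2 * (s - h)))) = u / 2 := by
    rw [hu, div_div, mul_comm (1 - _) (2 : ℝ)]
  rw [e]
  linarith

/-- Lets a sum of terms h e^{-2|t|} along a chain telescope into a bounded increment of tanh. -/
theorem Real.mul_exp_le_tanh_sub {t h : ℝ} (h0 : 0 ≤ h) (h1 : h ≤ 1) :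
    h * Real.exp (-2 * |t| - 1) ≤ Real.tanh (t + h) - Real.tanh t := by
  have hct := Real.cosh_pos t
  have hcth := Real.cosh_pos (t + h)
  have e : Real.tanh (t + h) - Real.tanh t = Real.sinh h / (Real.cosh t * Real.cosh (t + h)) := by
    rw [Real.tanh_eq_sinh_div_cosh, Real.tanh_eq_sinh_div_cosh, div_sub_div _ _ hcth.ne' hct.ne',
      mul_comm (Real.cosh t)]
    congr 1
    rw [← Real.sinh_sub (t + h) t, add_sub_cancel_left]
  have hc : ∀ x : ℝ, Real.cosh x ≤ Real.exp |x| := by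
    intro x
    rw [Real.cosh_eq]
    have a1 := Real.exp_le_exp.2 (le_abs_self x)
    have a2 := Real.exp_le_exp.2 (neg_le_abs x)
    linarith
  have hth : |t + h| ≤ |t| + 1 := (abs_add_le t h).trans (by rw [abs_of_nonneg h0]; linarith)
  have hprod : Real.cosh t * Real.cosh (t + h) ≤ Real.exp (2 * |t| + 1) := by
    calc Real.cosh t * Real.cosh (t + h) ≤ Real.exp |t| * Real.exp (|t| + 1) :=
          mul_le_mul (hc t) ((hc _).trans (Real.exp_le_exp.2 hth)) hcth.le (Real.exp_pos _).le
      _ = Real.exp (2 * |t| + 1) := by rw [← Real.exp_add]; ring_nf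
  rw [e, le_div_iff₀ (by positivity)]
  calc h * Real.exp (-2 * |t| - 1) * (Real.cosh t * Real.cosh (t + h))
      ≤ h * Real.exp (-2 * |t| - 1) * Real.exp (2 * |t| + 1) := by gcongr
    _ = h := by rw [mul_assoc, ← Real.exp_add]; ring_nf; simp
    _ ≤ Real.sinh h := Real.self_le_sinh_iff.2 h0

/-- The loss in the localization of a chain that recedes from `K` at unit speed is controlled by a
bounded monotone function of the time. -/
theorem exists_artanh_le_add_tanh {s₀ : ℝ} (hs₀ : 0 < s₀) (R : ℝ) : ∃ C, 0 ≤ C ∧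
    ∀ s h t : ℝ, 0 ≤ h → h ≤ s₀ / 2 → h ≤ 1 → s₀ ≤ s → |t| - R ≤ s →
      Real.artanh (Real.tanh h / Real.tanh s) ≤ h + C * (Real.tanh (t + h) - Real.tanh t) := by
  have hd : 0 < 1 - Real.exp (-s₀) := by
    rw [sub_pos, Real.exp_lt_one_iff]
    linarith
  refine ⟨(Real.exp 2 + 1) * Real.exp (2 * R + 1) / (1 - Real.exp (-s₀)), by positivity, ?_⟩
  intro s h t h0 hhs h1 hs ht
  refine (Real.artanh_tanh_div_tanh_le h0 (by linarith)).trans (add_le_add_right ?_ h)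
  have a1 : Real.exp (-2 * (s - h)) ≤ Real.exp (-s₀) := Real.exp_le_exp.2 (by linarith)
  have a2 : Real.exp (2 * h) - Real.exp (-2 * h) ≤ 2 * h * (Real.exp 2 + 1) := by
    have b1 := Real.add_one_le_exp (-2 * h)
    have b2 : Real.exp (2 * h) * Real.exp (-2 * h) = 1 := by rw [← Real.exp_add]; simp
    have b3 : Real.exp (2 * h) ≤ Real.exp 2 := Real.exp_le_exp.2 (by linarith)
    nlinarith [mul_le_mul_of_nonneg_left b1 (Real.exp_pos (2 * h)).le,
      mul_le_mul_of_nonneg_left b3 h0]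
  have a3 : Real.exp (-2 * s) ≤ Real.exp (2 * R + 1) * Real.exp (-2 * |t| - 1) := by
    rw [← Real.exp_add]
    exact Real.exp_le_exp.2 (by linarith)
  have a4 := Real.mul_exp_le_tanh_sub (t := t) h0 h1
  calc Real.exp (-2 * s) * (Real.exp (2 * h) - Real.exp (-2 * h)) /
        (2 * (1 - Real.exp (-2 * (s - h))))
      ≤ (Real.exp (2 * R + 1) * Real.exp (-2 * |t| - 1)) * (2 * h * (Real.exp 2 + 1)) /
        (2 * (1 - Real.exp (-s₀))) := by
        have : Real.exp (-2 * h) ≤ Real.exp (2 * h) := Real.exp_le_exp.2 (by linarith)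
        have := sub_nonneg.2 this
        gcongr
    _ = (Real.exp 2 + 1) * Real.exp (2 * R + 1) / (1 - Real.exp (-s₀)) *
        (h * Real.exp (-2 * |t| - 1)) := by
        field_simp
    _ ≤ _ := by gcongr

/-! ### Bounded detours around K -/

/-- Near `K`, the Kobayashi distance of `G \ K` is bounded: along a line avoiding `K` one leaves
a neighbourhood of `K` in boundedly many steps. -/
theorem exists_bound_near {G K : Set (Cn n)} (hG : IsOpen G) (hK : IsCompact K) (hKG : K ⊆ G)
    (hL : LinesAvoid K) (hD : IsDomainSet (G \ K)) :
    ∃ r > 0, ∃ M, ∀ x ∈ thickening r K, x ∉ K → ∀ y ∈ thickening r K, y ∉ K →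
      ∃ c ≤ M, HolChain (G \ K) 1 x y c := by
  obtain ⟨δ, hδ, hδG⟩ := hK.exists_cthickening_subset_open hG hKG
  obtain ⟨r, rfl⟩ : ∃ r, δ = 2 * r := ⟨δ / 2, by ring⟩
  have hr : 0 < r := by linarith
  have hSc : IsCompact (cthickening (2 * r) K \ thickening r K) :=
    hK.cthickening.diff isOpen_thickening
  have hSD : cthickening (2 * r) K \ thickening r K ⊆ G \ K := fun x hx =>
    ⟨hδG hx.1, fun hxK => hx.2 (self_subset_thickening hr K hxK)⟩
  obtain ⟨o, ho⟩ := hD.2.nonempty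
  obtain ⟨R, hR⟩ := hD.exists_bound_of_isCompact one_pos hSc hSD ho
  obtain ⟨B, hB⟩ := Metric.isBounded_iff.1 (hK.isBounded.thickening (δ := r))
  -- N steps of Euclidean length r/2 exceed the diameter bound B, so the walk must have left the
  -- r-neighbourhood by then.
  obtain ⟨N, hN⟩ := exists_nat_gt (B / (r / 2))
  rw [div_lt_iff₀ (by positivity)] at hN
  set a := Real.artanh (1 / 2) with ha
  have ha0 : 0 ≤ a := Real.artanh_nonneg (by norm_num)
  have key : ∀ x ∈ thickening r K, x ∉ K → ∃ c ≤ R + N * a, HolChain (G \ K) 1 o x c := by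
    intro x hx hxK
    obtain ⟨u, hu, hKu⟩ := hL.exists_direction hxK
    have hxG : ∀ y ∈ thickening r K, ∀ v, dist v y < r → v ∈ cthickening (2 * r) K := by
      intro y hy v hv
      obtain ⟨p, hp, hyp⟩ := mem_thickening_iff.1 hy
      refine mem_cthickening_of_dist_le v p _ _ hp ?_
      linarith [dist_triangle v y p]
    -- Each step uses a disc of radius r in the line, which stays in the closed 2r-neighbourhood;
    -- the first point outside the r-neighbourhood therefore lies in the compact shell.
    have hwalk : ∀ j : ℕ, (∃ p ∈ cthickening (2 * r) K \ thickening r K, ∃ c ≤ j * a,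
        HolChain (G \ K) 1 x p c) ∨ (x + ((j * (r / 2) : ℝ) : ℂ) • u ∈ thickening r K ∧
        HolChain (G \ K) 1 x (x + ((j * (r / 2) : ℝ) : ℂ) • u) (j * a)) := by
      intro j
      induction j with
      | zero =>
        right
        simp only [Nat.cast_zero, zero_mul, Complex.ofReal_zero, zero_smul, add_zero]
        exact ⟨hx, .refl ⟨hδG (thickening_subset_cthickening_of_le (by linarith) K hx), hxK⟩⟩
      | succ j ih =>
        rcases ih with ⟨p, hp, c, hc, h⟩ | ⟨hmem, h⟩
        · exact Or.inl ⟨p, hp, c, hc.trans (by push_cast; linarith), h⟩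
        · have hnear : ∀ l : ℂ, ‖l‖ < 1 →
              dist (x + ((j * (r / 2) : ℝ) : ℂ) • u + l • ((r : ℂ) • u))
                (x + ((j * (r / 2) : ℝ) : ℂ) • u) < r := by
            intro l hl
            rw [dist_eq_norm, add_sub_cancel_left, norm_smul, norm_smul, hu, Complex.norm_real,
              Real.norm_of_nonneg hr.le]
            nlinarith
          have hstep := holStep_of_line (D := G \ K) (x := x + ((j * (r / 2) : ℝ) : ℂ) • u)
            (v := (r : ℂ) • u) (fun l hl => ⟨hδG (hxG _ hmem _ (hnear l (by simpa using hl))), by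
              rw [smul_smul, add_assoc, ← add_smul]
              exact hKu _⟩) (t := 1 / 2) (by norm_num) (by norm_num)
          have heq : x + ((j * (r / 2) : ℝ) : ℂ) • u + ((1 / 2 : ℝ) : ℂ) • ((r : ℂ) • u) =
              x + (((j + 1 : ℕ) * (r / 2) : ℝ) : ℂ) • u := by
            rw [smul_smul, add_assoc, ← add_smul]
            congr 2
            push_cast
            ring
          have hcth := hxG _ hmem _ (hnear ((1 / 2 : ℝ) : ℂ) (by norm_num))
          rw [heq] at hstep hcth
          have hchain := h.trans (hstep.chain one_pos)
          have hlen : (j : ℝ) * a + Real.artanh (1 / 2) = ((j + 1 : ℕ) : ℝ) * a := by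
            push_cast
            ring
          rw [hlen] at hchain
          by_cases hin : x + (((j + 1 : ℕ) * (r / 2) : ℝ) : ℂ) • u ∈ thickening r K
          · exact Or.inr ⟨hin, hchain⟩
          · exact Or.inl ⟨_, ⟨hcth, hin⟩, _, le_rfl, hchain⟩
    rcases hwalk N with ⟨p, hp, c, hc, h⟩ | ⟨hmem, -⟩
    · obtain ⟨c', hc', h'⟩ := hR p hp
      exact ⟨c' + c, add_le_add hc' hc, h'.trans h.symm⟩
    · have := hB hmem hx
      rw [dist_eq_norm, add_sub_cancel_left, norm_smul, hu, Complex.norm_real,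
        Real.norm_of_nonneg (by positivity)] at this
      linarith
  refine ⟨r, hr, (R + N * a) + (R + N * a), fun x hx hxK y hy hyK => ?_⟩
  obtain ⟨c, hc, h⟩ := key x hx hxK
  obtain ⟨c', hc', h'⟩ := key y hy hyK
  exact ⟨c + c', add_le_add hc hc', h.symm.trans h'⟩

/-! ### Comparison of the two distances -/

/-- Removing `K` changes the Kobayashi distance by a bounded amount. -/
theorem exists_chainDist_diff_le {G K : Set (Cn n)} (hG : IsDomainSet G)
    (hb : Bornology.IsBounded G) (hK : IsCompact K) (hKG : K ⊆ G) (hL : LinesAvoid K)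
    (hD : IsDomainSet (G \ K)) :
    ∃ C, ∀ z ∈ G \ K, ∀ w ∈ G \ K, chainDist (G \ K) z w ≤ chainDist G z w + C := by
  obtain ⟨r, hr, M, hM⟩ := exists_bound_near hG.1 hK hKG hL hD
  obtain ⟨o, ho⟩ := hG.2.nonempty
  obtain ⟨R₀, hR₀⟩ := hG.exists_bound_of_isCompact one_pos hK hKG ho
  obtain ⟨RG', hRG'⟩ := Metric.isBounded_iff.1 hb
  obtain ⟨RG, hRGpos, hRG⟩ : ∃ RG > 0, ∀ x ∈ G, ∀ y ∈ G, dist x y ≤ RG :=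
    ⟨max RG' 1, by positivity, fun x hx y hy => (hRG' hx hy).trans (le_max_left _ _)⟩
  -- Points at Euclidean distance at least r from K have Kobayashi distance at least s₀ from K, by
  -- `HolChain.dist_le`.
  set s₀ := r / (2 * RG) with hs₀
  have hs₀pos : 0 < s₀ := by positivity
  obtain ⟨C, hC0, hC⟩ := exists_artanh_le_add_tanh hs₀pos (R₀ + 2)
  set δ := min (s₀ / 2) 1 with hδ
  have hδpos : 0 < δ := by positivity
  have hM0 : 0 ≤ max M 0 := le_max_right _ _
  refine ⟨1 + 2 * C + max M 0, fun z hz w hw => ?_⟩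
  set A := chainDist G o z with hA
  set B := chainDist G o w with hB
  obtain ⟨T, hT, hzw⟩ := hG.exists_holChain_lt hz.1 hw.1 hδpos
    (lt_add_of_pos_right (chainDist G z w) one_pos)
  have hTAB : T ≤ A + B + 1 := by
    have := hG.chainDist_triangle hz.1 ho hw.1
    rw [chainDist_comm G z o] at this
    linarith
  -- The lower bounds A - c and B - (T - c) for the distance from o to the chain at length c agree
  -- at c = τ, with common value (A + B - T)/2 ≥ -1/2.
  set τ := (A + T - B) / 2 with hτ
  set ψ : ℝ → ℝ := fun c => c + C * (Real.tanh (c - τ) - Real.tanh (-τ)) with hψ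
  -- The slack is 2, not the 1 of `hfar`, because a step leaving the neighbourhood is localized at
  -- its endpoint but charged from its start, an offset of at most 1.
  have hstep : ∀ c h y y', y ∈ G → HolStep G y y' h → h ≤ δ → y ∉ thickening r K →
      |c - τ| - 2 ≤ chainDist G o y → ∃ h', HolStep (G \ K) y y' h' ∧ h' ≤ ψ (c + h) - ψ c := by
    intro c h y y' hy hs hh hyU hcy
    have hh1 := hh.trans (min_le_left _ _)
    refine ⟨_, hs.localize (s := max s₀ (|c - τ| - (R₀ + 2)))
      (lt_max_of_lt_left (by linarith)) fun p hp c' hc' => max_le ?_ ?_, ?_⟩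
    · have h1 := hc'.dist_le hRG
      have h2 : r ≤ dist y p := by
        by_contra! hlt
        exact hyU (mem_thickening_iff.2 ⟨p, hp, hlt⟩)
      rw [hs₀, div_le_iff₀ (by positivity)]
      linarith
    · obtain ⟨c'', hc'', hop⟩ := hR₀ p hp
      have := (hop.trans hc'.symm).chainDist_le
      linarith
    · have := hC (max s₀ (|c - τ| - (R₀ + 2))) h (c - τ) hs.nonneg hh1
        (hh.trans (min_le_right _ _)) (le_max_left _ _) (le_max_right _ _)
      rw [show c - τ + h = c + h - τ by ring] at this
      simp only [hψ]
      linarith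
  have hψmono : ∀ c h, 0 ≤ h → ψ c ≤ ψ (c + h) := by
    intro c h h0
    have : Real.tanh (c - τ) ≤ Real.tanh (c + h - τ) := Real.tanh_le_tanh_iff.2 (by linarith)
    have := mul_le_mul_of_nonneg_left this hC0
    simp only [hψ]
    linarith
  have hfar : ∀ y c, HolChain G δ z y c → chainDist G y w ≤ T - c →
      |c - τ| - 1 ≤ chainDist G o y := by
    intro y c hzy hyw
    have h1 := hzy.chainDist_le
    have h2 := hG.chainDist_triangle ho hzy.right_mem hz.1
    have h3 := hG.chainDist_triangle ho hzy.right_mem hw.1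
    rw [chainDist_comm G y z] at h2
    rw [sub_le_iff_le_add, abs_le]
    constructor <;> linarith
  -- Here u is the first point of the chain in the neighbourhood of K and u' the last one before y.
  -- Only these two are kept, so a single detour suffices at the end however often the chain
  -- returns.
  have main : ∀ y c, HolChain G δ z y c → chainDist G y w ≤ T - c →
      (y ∉ thickening r K ∧ ((∃ a ≤ ψ c, HolChain (G \ K) 1 z y a) ∨
        ∃ u ∈ thickening r K, ∃ u' ∈ thickening r K, ∃ a b, a + b ≤ ψ c ∧
          HolChain (G \ K) 1 z u a ∧ HolChain (G \ K) 1 u' y b)) ∨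
      (y ∈ thickening r K ∧ ∃ u ∈ thickening r K, ∃ a ≤ ψ c, HolChain (G \ K) 1 z u a) := by
    intro y c hzy
    induction hzy with
    | refl _ =>
      intro _
      have h0 : (0 : ℝ) ≤ ψ 0 := by simp [hψ]
      by_cases hzU : z ∈ thickening r K
      · exact Or.inr ⟨hzU, z, hzU, 0, h0, .refl hz⟩
      · exact Or.inl ⟨hzU, Or.inl ⟨0, h0, .refl hz⟩⟩
    | @snoc y y' c h hzy hs hh ih =>
      intro hy'w
      have hy'chain := hzy.snoc hs hh
      have hfar' := hfar y' _ hy'chain hy'w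
      have hyw : chainDist G y w ≤ T - c := by
        have h1 := (hs.chain one_pos).chainDist_le
        have h2 := hG.chainDist_triangle hzy.right_mem hs.right_mem hw.1
        linarith
      have hfary := hfar y c hzy hyw
      have hm := hψmono c h hs.nonneg
      rcases ih hyw with ⟨hyU, hcase⟩ | ⟨hyU, u, hu, a, ha, hzu⟩
      · obtain ⟨h', hs', hh'⟩ := hstep c h y y' hzy.right_mem hs hh hyU (by linarith)
        have hyy' := hs'.chain one_pos
        rcases hcase with ⟨a, ha, hza⟩ | ⟨u, hu, u', hu', a, b, hab, hzu, huy⟩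
        · have := hza.trans hyy'
          by_cases hy'U : y' ∈ thickening r K
          · exact Or.inr ⟨hy'U, y', hy'U, _, by linarith, this⟩
          · exact Or.inl ⟨hy'U, Or.inl ⟨_, by linarith, this⟩⟩
        · by_cases hy'U : y' ∈ thickening r K
          · exact Or.inr ⟨hy'U, u, hu, a, by linarith [huy.nonneg], hzu⟩
          · exact Or.inl ⟨hy'U, Or.inr ⟨u, hu, u', hu', a, b + h', by linarith, hzu,
              huy.trans hyy'⟩⟩
      · by_cases hy'U : y' ∈ thickening r K
        · exact Or.inr ⟨hy'U, u, hu, a, by linarith, hzu⟩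
        · have hcc : |c - τ| ≤ |c + h - τ| + 1 := by
            have h1 := abs_add_le (c + h - τ) (-h)
            rw [show c + h - τ + -h = c - τ by ring, abs_neg, abs_of_nonneg hs.nonneg] at h1
            linarith [hh.trans (min_le_right _ _)]
          -- The start y may be close to K or on it a priori, so the reversed step is localized at
          -- y'; this also shows that y is not in K.
          obtain ⟨h', hs', hh'⟩ := hstep c h y' y hs.right_mem hs.symm hh hy'U (by linarith)
          exact Or.inl ⟨hy'U, Or.inr ⟨u, hu, y, hyU, a, h', by linarith, hzu,
            hs'.symm.chain one_pos⟩⟩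
  have hψT : ψ T ≤ T + 2 * C := by
    have h1 := Real.tanh_lt_one (T - τ)
    have h2 := Real.neg_one_lt_tanh (-τ)
    simp only [hψ]
    nlinarith
  have hMM : M ≤ max M 0 := le_max_left _ _
  rcases main w T hzw (by rw [chainDist_self hw.1, sub_self]) with
    ⟨-, ⟨a, ha, h⟩ | ⟨u, hu, u', hu', a, b, hab, hzu, huw⟩⟩ | ⟨hwU, u, hu, a, ha, hzu⟩
  · linarith [h.chainDist_le]
  · obtain ⟨c, hc, huu⟩ := hM u hu hzu.right_mem.2 u' hu' huw.left_mem.2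
    linarith [((hzu.trans huu).trans huw).chainDist_le]
  · obtain ⟨c, hc, huu⟩ := hM u hu hzu.right_mem.2 w hwU hw.2
    linarith [(hzu.trans huu).chainDist_le]

/-! ### Gromov hyperbolicity and the final statement -/

theorem chainDist_anti {D D' : Set (Cn n)} (hDD : D ⊆ D') (hD : IsDomainSet D) {x y : Cn n}
    (hx : x ∈ D) (hy : y ∈ D) : chainDist D' x y ≤ chainDist D x y :=
  hD.le_chainDist hx hy fun _ hc => (hc.refine hDD one_pos).chainDist_le

/-- Gromov hyperbolicity passes to a subset with a distance that differs by a bounded amount from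
the restricted one. -/
theorem GromovHyperbolic.of_rough_isometry {X Y : Type*} {d : X → X → ℝ} {d' : Y → Y → ℝ}
    (hd : GromovHyperbolic d) (hd' : IsDistance d') (f : Y → X) {C : ℝ}
    (h1 : ∀ x y, d (f x) (f y) ≤ d' x y) (h2 : ∀ x y, d' x y ≤ d (f x) (f y) + C) :
    GromovHyperbolic d' := by
  obtain ⟨-, C₀, hC₀⟩ := hd
  -- The minimum rises by at most 2C and the subtracted product falls by at most 2C.
  refine ⟨hd', C₀ + 4 * C, fun p q x w => ?_⟩
  have hC := hC₀ (f p) (f q) (f x) (f w)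
  have hCnn : 0 ≤ C := by linarith [h1 p p, h2 p p]
  have hup : ∀ a b : Y, gromovProduct d' a b w ≤ gromovProduct d (f a) (f b) (f w) + 2 * C := by
    intro a b
    unfold gromovProduct
    linarith [h2 a w, h2 w b, h1 a b]
  have hlow : gromovProduct d (f p) (f q) (f w) - 2 * C ≤ gromovProduct d' p q w := by
    unfold gromovProduct
    linarith [h1 p w, h1 w q, h2 p q]
  have hmin : min (gromovProduct d' p x w) (gromovProduct d' x q w) ≤
      min (gromovProduct d (f p) (f x) (f w)) (gromovProduct d (f x) (f q) (f w)) + 2 * C := by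
    rw [← min_add_add_right]
    exact min_le_min (hup p x) (hup x q)
  linarith

theorem proposition6 (n : ℕ) (hn : 2 ≤ n) :
    (∀ G K : Set (Cn n), IsDomainSet G → Bornology.IsBounded G → IsCompact K → K ⊆ G →
      LinesAvoid K →
        IsDomainSet (G \ K) ∧
        QuasiIsometricallyEquivalent (kobayashi (G \ K))
          (fun z w : ↥(G \ K) => kobayashi G ⟨z.1, z.2.1⟩ ⟨w.1, w.2.1⟩) ∧
        (GromovHyperbolic (kobayashi G) → GromovHyperbolic (kobayashi (G \ K)))) ∧
    (∀ K : Set (Cn n), IsCompact K → Convex ℝ K → LinesAvoid K) := by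
  refine ⟨fun G K hG hb hK hKG hL => ?_, fun K hK hc => linesAvoid_of_convex hn hK hc⟩
  have hD := isDomainSet_diff hn hG hK hKG hL
  have hdist := hD.isDistance_kobayashi (hb.subset Set.sdiff_subset)
  have hdistG := hG.isDistance_kobayashi hb
  obtain ⟨C, hC⟩ := exists_chainDist_diff_le hG hb hK hKG hL hD
  have hle : ∀ x y : ↥(G \ K), kobayashi G ⟨x.1, x.2.1⟩ ⟨y.1, y.2.1⟩ ≤ kobayashi (G \ K) x y := by
    intro x y
    rw [hG.kobayashi_eq, hD.kobayashi_eq]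
    exact chainDist_anti Set.sdiff_subset hD x.2 y.2
  have hge : ∀ x y : ↥(G \ K),
      kobayashi (G \ K) x y ≤ kobayashi G ⟨x.1, x.2.1⟩ ⟨y.1, y.2.1⟩ + C := by
    intro x y
    rw [hG.kobayashi_eq, hD.kobayashi_eq]
    exact hC x.1 x.2 y.1 y.2
  refine ⟨hD, ⟨hdist, ⟨fun x y => hdistG.nonneg _ _, fun x y => ?_, fun x y => hdistG.symm _ _,
    fun x y z => hdistG.triangle _ _ _⟩, 1, |C| + 1, one_pos, by positivity, fun x y => ?_⟩,
    fun h => h.of_rough_isometry hdist (fun x => ⟨x.1, x.2.1⟩) hle hge⟩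
  · rw [hdistG.eq_zero_iff, Subtype.mk.injEq, Subtype.ext_iff]
  · have h1 := hle x y
    have h2 := hge x y
    have h3 := le_abs_self C
    have h4 := abs_nonneg C
    simp only [id, inv_one, one_mul]
    constructor <;> linarith
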